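/- Let $\Omega\subset\mathbb R^3$ be a bounded, open, connected Lipschitz domain, let $\Omega_1\subset\Omega$ be measurable (the region of the first material; the second material fills $\Omega\setminus\Omega_1$), and let $c>0$. Let $\mathbb C^+=\{z\in\mathbb C:\operatorname{Im}z>0\}$ and, for $\mathbf Z=(Z_1,Z_2,Z_3,Z_4)=(\omega\varepsilon_1,\omega\varepsilon_2,\omega\mu_1,\omega\mu_2)\in(\mathbb C^+)^4$, let $\omega\varepsilon$ and $\omega\mu$ be the piecewise constant functions on $\Omega$ equal to $Z_1$ and $Z_3$ on $\Omega_1$ and to $Z_2$ and $Z_4$ on $\Omega\setminus\Omega_1$. Let $H(\mathrm{curl},\Omega)$ be the space of complex vector fields $u\in L^2(\Omega)^3$ whose weak curl lies in $L^2(\Omega)^3$, and let $H_0(\mathrm{curl},\Omega)$ be the subspace of those $u\in H(\mathrm{curl},\Omega)$ with $u\times n=0$ on $\partial\Omega$, i.e. $\int_\Omega (u\cdot\mathrm{curl}\,v-v\cdot\mathrm{curl}\,u)\,dx=0$ for all $v\in H(\mathrm{curl},\Omega)$. It is a Hilbert space with the norm $\|u\|^2=\|u\|_{L^2}^2+\|\mathrm{curl}\,u\|_{L^2}^2$;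 $H_0(\mathrm{curl},\Omega)^*$ denotes its dual, the space of continuous linear functionals with the operator norm. Here $a\cdot b=\sum_i a_ib_i$ without conjugation. For $\phi,\psi\in H_0(\mathrm{curl},\Omega)$ put $$a_{\mathbf Z}(\phi,\psi)=\int_\Omega -c^2(\omega\mu)^{-1}\,\mathrm{curl}\,\phi\cdot\overline{\mathrm{curl}\,\psi}+\omega\varepsilon\,\phi\cdot\overline{\psi}\;dx ,$$ and let $A_{\mathbf Z}:H_0(\mathrm{curl},\Omega)\to H_0(\mathrm{curl},\Omega)^*$ be the continuous linear operator $\langle A_{\mathbf Z}\phi,\psi\rangle=a_{\mathbf Z}(\phi,\overline\psi)$. Then for every $\mathbf Z\in(\mathbb C^+)^4$ the operator $A_{\mathbf Z}$ is an isomorphism (a linear bijection, continuous with continuous inverse) from $H_0(\mathrm{curl},\Omega)$ onto $H_0(\mathrm{curl},\Omega)^*$, and $\mathbf Z\mapsto A_{\mathbf Z}^{-1}$ is analytic on $(\mathbb C^+)^4$ with values in the bounded linear operators $H_0(\mathrm{curl},\Omega)^*\to H_0(\mathrm{curl},\Omega)$ with the operator norm. -/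

import Mathlib

open MeasureTheory Set
open scoped ContDiff ComplexConjugate ENNReal NNReal

noncomputable section

namespace CurlCurl

/-- Physical space `ℝ³`, with its Euclidean norm and Lebesgue measure. -/
abbrev E3 := EuclideanSpace ℝ (Fin 3)

/-- Values of complex vector fields, `ℂ³`. -/
abbrev C3 := EuclideanSpace ℂ (Fin 3)

/-! ### Lipschitz domains -/

/-- A boundary chart of `Ω`: in the open cylinder with (arbitrarily placed and oriented) axis,
of radius `α` and height `4β`, the set `Ω` is the strict subgraph of a Lipschitz function `ξ` whose
graph is the part of the boundary of `Ω` inside the cylinder. -/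
structure LipschitzChart (Ω : Set E3) where
  center : E3
  rot : E3 ≃ₗᵢ[ℝ] E3
  α : ℝ
  β : ℝ
  α_pos : 0 < α
  β_pos : 0 < β
  ξ : EuclideanSpace ℝ (Fin 2) → ℝ
  lipschitz : ∃ K : ℝ≥0, LipschitzOnWith K ξ (Metric.closedBall 0 α)
  bound : ∀ y ∈ Metric.closedBall (0 : EuclideanSpace ℝ (Fin 2)) α, |ξ y| ≤ β
  frontier_iff : ∀ x : E3, ‖!₂[x 0, x 1]‖ < α → |x 2| < 2 * β →
    (rot x + center ∈ frontier Ω ↔ x 2 = ξ !₂[x 0, x 1])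
  inside_iff : ∀ x : E3, ‖!₂[x 0, x 1]‖ < α → |x 2| < 2 * β →
    (rot x + center ∈ Ω ↔ x 2 < ξ !₂[x 0, x 1])
  outside_iff : ∀ x : E3, ‖!₂[x 0, x 1]‖ < α → |x 2| < 2 * β →
    (rot x + center ∉ closure Ω ↔ ξ !₂[x 0, x 1] < x 2)

/-- The open cylinder of a chart. -/
def LipschitzChart.cylinder {Ω : Set E3} (C : LipschitzChart Ω) : Set E3 :=
  {p | ∃ x : E3, ‖!₂[x 0, x 1]‖ < C.α ∧ |x 2| < 2 * C.β ∧ p = C.rot x + C.center}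

/-- An open connected bounded Lipschitz domain: finitely many charts cover its boundary. -/
structure IsBoundedLipschitzDomain (Ω : Set E3) : Prop where
  isOpen : IsOpen Ω
  isConnected : IsConnected Ω
  isBounded : Bornology.IsBounded Ω
  charts : ∃ (m : ℕ) (C : Fin m → LipschitzChart Ω), frontier Ω ⊆ ⋃ j, (C j).cylinder

/-! ### Vector fields -/

/-- The product `a · b = a₁ b₁ + a₂ b₂ + a₃ b₃` on `ℂ³` (without conjugation). -/
def dot (a b : C3) : ℂ := ∑ i, a i * b i

/-- Componentwise complex conjugation on `ℂ³`. -/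
def conjC3 : C3 →SL[starRingEnd ℂ] C3 where
  toFun a := WithLp.toLp 2 fun i => conj (a i)
  map_add' a b := by ext i; simp
  map_smul' c a := by ext i; simp
  cont := (PiLp.continuous_toLp 2 _).comp
    (continuous_pi fun i => Complex.continuous_conj.comp (EuclideanSpace.proj (𝕜 := ℂ) i).continuous)

/-- The classical curl of a differentiable vector field `φ : ℝ³ → ℂ³`. -/
def curl (φ : E3 → C3) (x : E3) : C3 :=
  let d (i j : Fin 3) : ℂ := fderiv ℝ φ x (EuclideanSpace.single i 1) j
  !₂[d 1 2 - d 2 1, d 2 0 - d 0 2, d 0 1 - d 1 0]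

/-- Test fields: smooth with compact support contained in `Ω`. -/
structure IsTestField (Ω : Set E3) (φ : E3 → C3) : Prop where
  smooth : ContDiff ℝ ∞ φ
  compact : HasCompactSupport φ
  support : tsupport φ ⊆ Ω

/-- `L²(Ω)`, square integrable complex vector fields on `Ω`. -/
abbrev L2Field (Ω : Set E3) := Lp C3 2 (volume.restrict Ω)

/-- `w` is the weak (distributional) curl of `u` on `Ω`. -/
def HasWeakCurl (Ω : Set E3) (u w : L2Field Ω) : Prop :=
  ∀ φ : E3 → C3, IsTestField Ω φ →
    ∫ x in Ω, dot (u x) (curl φ x) = ∫ x in Ω, dot (w x) (φ x)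

@[simp] lemma conjC3_apply (a : C3) (i : Fin 3) : conjC3 a i = conj (a i) := rfl

lemma conjC3_conjC3 (a : C3) : conjC3 (conjC3 a) = a := by ext i; simp

lemma norm_conjC3 (a : C3) : ‖conjC3 a‖ = ‖a‖ := by simp [EuclideanSpace.norm_eq]

/-- The product `dot` as a continuous bilinear map. -/
def dotL : C3 →L[ℂ] C3 →L[ℂ] ℂ :=
  LinearMap.mkContinuous₂ (LinearMap.mk₂ ℂ dot
    (fun a a' b => by simp [dot, add_mul, Finset.sum_add_distrib])
    (fun c a b => by simp [dot, Finset.mul_sum, mul_assoc])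
    (fun a b b' => by simp [dot, mul_add, Finset.sum_add_distrib])
    (fun c a b => by simp [dot, Finset.mul_sum, mul_left_comm])) 1 (fun a b => by
      have h : dot a b = inner ℂ (conjC3 a) b := by
        simp [dot, PiLp.inner_apply, mul_comm]
      rw [LinearMap.mk₂_apply, h, one_mul, ← norm_conjC3 a]
      exact norm_inner_le_norm _ _)

@[simp] lemma dotL_apply (a b : C3) : dotL a b = dot a b := rfl

lemma norm_dot_le (a b : C3) : ‖dot a b‖ ≤ ‖a‖ * ‖b‖ := by
  have h : dot a b = inner ℂ (conjC3 a) b := by simp [dot, PiLp.inner_apply, mul_comm]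
  rw [h, ← norm_conjC3 a]
  exact norm_inner_le_norm _ _

lemma conj_dot (a b : C3) : conj (dot a b) = dot (conjC3 a) (conjC3 b) := by simp [dot]

lemma memLp_dot {Ω : Set E3} {u v : E3 → C3} (hu : MemLp u 2 (volume.restrict Ω))
    (hv : MemLp v 2 (volume.restrict Ω)) :
    Integrable (fun x => dot (u x) (v x)) (volume.restrict Ω) := by
  have h := MemLp.integrable_mul hu.norm hv.norm
  refine h.mono' ?_ (Filter.Eventually.of_forall fun x => norm_dot_le _ _)
  exact dotL.aestronglyMeasurable_comp₂ hu.1 hv.1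

lemma IsTestField.memLp {Ω : Set E3} {φ : E3 → C3} (hφ : IsTestField Ω φ) (μ : Measure E3)
    [IsFiniteMeasureOnCompacts μ] : MemLp φ 2 μ :=
  hφ.smooth.continuous.memLp_of_hasCompactSupport hφ.compact

/-- The curl as a linear function of the derivative. -/
def curlL : (E3 →L[ℝ] C3) →ₗ[ℝ] C3 where
  toFun T :=
    let d (i j : Fin 3) : ℂ := T (EuclideanSpace.single i 1) j
    !₂[d 1 2 - d 2 1, d 2 0 - d 0 2, d 0 1 - d 1 0]
  map_add' S T := by ext i; fin_cases i <;> simp <;> ring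
  map_smul' c T := by ext i; fin_cases i <;> simp [mul_sub]

lemma curl_eq (φ : E3 → C3) : curl φ = fun x => curlL (fderiv ℝ φ x) := rfl

lemma IsTestField.curl_memLp {Ω : Set E3} {φ : E3 → C3} (hφ : IsTestField Ω φ) (μ : Measure E3)
    [IsFiniteMeasureOnCompacts μ] : MemLp (curl φ) 2 μ := by
  have hc : Continuous (curl φ) :=
    curlL.continuous_of_finiteDimensional.comp (hφ.smooth.continuous_fderiv (by simp))
  refine hc.memLp_of_hasCompactSupport ?_
  have h1 := hφ.compact.fderiv (𝕜 := ℝ)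
  exact h1.comp_left (g := curlL) (map_zero curlL)

/-- Conjugation as a real-linear map. -/
def conjC3R : C3 →L[ℝ] C3 :=
  LinearMap.toContinuousLinearMap
    { toFun := conjC3
      map_add' := map_add _
      map_smul' := fun c a => by ext i; simp }

lemma IsTestField.conj {Ω : Set E3} {φ : E3 → C3} (hφ : IsTestField Ω φ) :
    IsTestField Ω (fun x => conjC3 (φ x)) where
  smooth := conjC3R.contDiff.comp hφ.smooth
  compact := hφ.compact.comp_left (g := conjC3) (map_zero _)
  support := (tsupport_comp_subset (map_zero conjC3) φ).trans hφ.support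

lemma curl_conj {φ : E3 → C3} (hφ : Differentiable ℝ φ) (x : E3) :
    curl (fun x => conjC3 (φ x)) x = conjC3 (curl φ x) := by
  have h : fderiv ℝ (fun x => conjC3 (φ x)) x = conjC3R.comp (fderiv ℝ φ x) :=
    (conjC3R.hasFDerivAt.comp x (hφ x).hasFDerivAt).fderiv
  ext i
  simp only [curl, h, ContinuousLinearMap.comp_apply, conjC3R]
  fin_cases i <;> simp

/-! ### The spaces `H(curl, Ω)` and `H₀(curl, Ω)` -/

lemma integrable_dot {Ω : Set E3} (u v : L2Field Ω) :
    Integrable (fun x => dot (u x) (v x)) (volume.restrict Ω) := memLp_dot (Lp.memLp u) (Lp.memLp v)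

lemma integral_dot_add {Ω : Set E3} (u u' : L2Field Ω) {v : E3 → C3}
    (hv : MemLp v 2 (volume.restrict Ω)) :
    ∫ x in Ω, dot ((u + u' : L2Field Ω) x) (v x)
      = (∫ x in Ω, dot (u x) (v x)) + ∫ x in Ω, dot (u' x) (v x) := by
  rw [← integral_add (memLp_dot (Lp.memLp u) hv) (memLp_dot (Lp.memLp u') hv)]
  refine integral_congr_ae ?_
  filter_upwards [Lp.coeFn_add u u'] with x hx
  rw [hx, Pi.add_apply]
  simp [dot, add_mul, Finset.sum_add_distrib]

lemma integral_dot_smul {Ω : Set E3} (c : ℂ) (u : L2Field Ω) (v : E3 → C3) :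
    ∫ x in Ω, dot ((c • u : L2Field Ω) x) (v x) = c * ∫ x in Ω, dot (u x) (v x) := by
  rw [← integral_const_mul]
  refine integral_congr_ae ?_
  filter_upwards [Lp.coeFn_smul c u] with x hx
  rw [hx, Pi.smul_apply]
  simp [dot, Finset.mul_sum, mul_assoc]

lemma integral_dot_comm {Ω : Set E3} (u v : E3 → C3) :
    ∫ x in Ω, dot (u x) (v x) = ∫ x in Ω, dot (v x) (u x) := by simp only [dot, mul_comm]

lemma integral_dot_conj {Ω : Set E3} (u : L2Field Ω) (v : E3 → C3) :
    ∫ x in Ω, dot ((conjC3.compLp u : L2Field Ω) x) (conjC3 (v x))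
      = conj (∫ x in Ω, dot (u x) (v x)) := by
  rw [← integral_conj]
  refine integral_congr_ae ?_
  filter_upwards [conjC3.coeFn_compLp u] with x hx
  rw [hx, conj_dot]

/-- `H(curl, Ω)`, the fields `u ∈ L²(Ω)` with `curl u ∈ L²(Ω)`, realised as the space of pairs
`(u, curl u)` in `L²(Ω) × L²(Ω)`. The `WithLp 2` norm of such a pair is
`(‖u‖² + ‖curl u‖²)^{1/2}`. -/
def HCurl (Ω : Set E3) : Submodule ℂ (WithLp 2 (L2Field Ω × L2Field Ω)) where
  carrier := {p | HasWeakCurl Ω p.fst p.snd}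
  zero_mem' := by
    intro φ hφ
    have h := integral_dot_smul (Ω := Ω) 0 0 (curl φ)
    have h' := integral_dot_smul (Ω := Ω) 0 0 φ
    simp only [zero_smul, zero_mul] at h h'
    exact h.trans h'.symm
  add_mem' := by
    intro p q hp hq φ hφ
    have := hp φ hφ
    have := hq φ hφ
    simp only [WithLp.add_fst, WithLp.add_snd, integral_dot_add _ _ (hφ.curl_memLp _),
      integral_dot_add _ _ (hφ.memLp _), *]
  smul_mem' := by
    intro c p hp φ hφ
    have := hp φ hφ
    simp only [WithLp.smul_fst, WithLp.smul_snd, integral_dot_smul, *]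

/-- The weak curl is unique, so that a pair in `HCurl Ω` is determined by its field. -/
lemma HasWeakCurl.unique {Ω : Set E3} (hΩ : IsOpen Ω) {u w w' : L2Field Ω}
    (h : HasWeakCurl Ω u w) (h' : HasWeakCurl Ω u w') : w = w' := by
  have key : ∀ i : Fin 3, ∀ᵐ x ∂volume, x ∈ Ω → w x i - w' x i = 0 := by
    intro i
    have hint : ∀ v : L2Field Ω, MemLp (fun x => v x i) 2 (volume.restrict Ω) := fun v =>
      (Lp.memLp v).of_le
        ((EuclideanSpace.proj (𝕜 := ℂ) i).continuous.comp_aestronglyMeasurable (Lp.memLp v).1)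
        (Filter.Eventually.of_forall fun x => PiLp.norm_apply_le _ _)
    have hmem : MemLp (fun x => w x i - w' x i) 2 (volume.restrict Ω) := (hint w).sub (hint w')
    refine hΩ.ae_eq_zero_of_integral_contDiff_smul_eq_zero ?_ ?_
    · rw [locallyIntegrableOn_iff hΩ.isLocallyClosed]
      intro k hk hkc
      have hm : MemLp (fun x => w x i - w' x i) 2 (volume.restrict k) :=
        hmem.mono_measure (Measure.restrict_mono hk le_rfl)
      have : IsFiniteMeasure (volume.restrict k : Measure E3) :=
        ⟨by simpa using hkc.measure_lt_top⟩
      exact hm.integrable (by norm_num)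
    · intro g hg hgc hgs
      set φ : E3 → C3 := fun x => (g x : ℂ) • EuclideanSpace.single i (1 : ℂ) with hφdef
      have hφ : IsTestField Ω φ := by
        refine ⟨?_, ?_, ?_⟩
        · exact (Complex.ofRealCLM.contDiff.comp hg).smul contDiff_const
        · exact hgc.comp_left (g := fun t : ℝ => (t : ℂ) • EuclideanSpace.single i (1 : ℂ))
            (by simp)
        · exact (tsupport_comp_subset
            (g := fun t : ℝ => (t : ℂ) • EuclideanSpace.single i (1 : ℂ)) (by simp) g).trans hgs
      have hdot : ∀ (v : L2Field Ω) x, dot (v x) (φ x) = (g x : ℂ) * v x i := by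
        intro v x
        simp [dot, hφdef, PiLp.single_apply, mul_comm]
      have e := (h φ hφ).symm.trans (h' φ hφ)
      have e2 : ∫ x in Ω, (dot (w x) (φ x) - dot (w' x) (φ x)) = 0 := by
        rw [integral_sub (memLp_dot (Lp.memLp w) (hφ.memLp _))
          (memLp_dot (Lp.memLp w') (hφ.memLp _)), e, sub_self]
      rw [← e2, ← setIntegral_eq_integral_of_forall_compl_eq_zero (s := Ω)]
      · refine integral_congr_ae (Filter.Eventually.of_forall fun x => ?_)
        simp [hdot, mul_sub]
      · intro x hx
        have : g x = 0 := by
          by_contra hne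
          exact hx (hgs (subset_tsupport g hne))
        simp [this]
  refine Lp.ext ?_
  have hall := ae_all_iff.2 key
  rw [Filter.EventuallyEq, ae_restrict_iff' hΩ.measurableSet]
  filter_upwards [hall] with x hx hxΩ
  ext i
  exact sub_eq_zero.1 (hx i hxΩ)

/-- The Green pairing `∫_Ω u · curl v - v · curl u`, which by Green's identity is the duality
product of the tangential traces `u × n` and `n × (v × n)` on the boundary of `Ω`. -/
def greenPairing {Ω : Set E3} (p q : WithLp 2 (L2Field Ω × L2Field Ω)) : ℂ :=
  ∫ x in Ω, (dot (p.fst x) (q.snd x) - dot (q.fst x) (p.snd x))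

lemma greenPairing_eq {Ω : Set E3} (p q : WithLp 2 (L2Field Ω × L2Field Ω)) :
    greenPairing p q
      = (∫ x in Ω, dot (p.fst x) (q.snd x)) - ∫ x in Ω, dot (p.snd x) (q.fst x) := by
  rw [greenPairing, integral_sub (integrable_dot _ _) (integrable_dot _ _),
    integral_dot_comm q.fst p.snd]

/-- `H₀(curl, Ω)`, the fields `u ∈ H(curl, Ω)` with `u × n = 0` on the boundary of `Ω`. The
tangential trace `u × n` is an element of the dual of the space of all tangential component traces
`n × (v × n)`, `v ∈ H(curl, Ω)`, acting through the Green pairing; it vanishes when the Green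
pairing of `u` with each `v ∈ H(curl, Ω)` does. -/
def H0CurlSubmodule (Ω : Set E3) : Submodule ℂ (WithLp 2 (L2Field Ω × L2Field Ω)) where
  carrier := {p | p ∈ HCurl Ω ∧ ∀ q ∈ HCurl Ω, greenPairing p q = 0}
  zero_mem' := by
    refine ⟨zero_mem _, fun q _ => ?_⟩
    have h : ∫ x in Ω, dot ((0 : L2Field Ω) x) (q.snd x) = 0 := by
      simpa using integral_dot_smul (Ω := Ω) 0 0 q.snd
    have h' : ∫ x in Ω, dot ((0 : L2Field Ω) x) (q.fst x) = 0 := by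
      simpa using integral_dot_smul (Ω := Ω) 0 0 q.fst
    rw [greenPairing_eq]
    exact (congrArg₂ (fun a b : ℂ => a - b) h h').trans (sub_zero 0)
  add_mem' := by
    intro p p' hp hp'
    refine ⟨add_mem hp.1 hp'.1, fun q hq => ?_⟩
    have h := hp.2 q hq
    have h' := hp'.2 q hq
    have e1 := integral_dot_add p.fst p'.fst (Lp.memLp q.snd)
    have e2 := integral_dot_add p.snd p'.snd (Lp.memLp q.fst)
    rw [greenPairing_eq] at h h' ⊢
    refine (congrArg₂ (fun a b : ℂ => a - b) e1 e2).trans ?_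
    linear_combination h + h'
  smul_mem' := by
    intro c p hp
    refine ⟨Submodule.smul_mem _ c hp.1, fun q hq => ?_⟩
    have h := hp.2 q hq
    have e1 := integral_dot_smul c p.fst q.snd
    have e2 := integral_dot_smul c p.snd q.fst
    rw [greenPairing_eq] at h ⊢
    refine (congrArg₂ (fun a b : ℂ => a - b) e1 e2).trans ?_
    linear_combination c * h

/-- `H₀(curl, Ω)` as a Hilbert space, with the norm `(‖u‖² + ‖curl u‖²)^{1/2}`. -/
def H0Curl (Ω : Set E3) : Type := H0CurlSubmodule Ω

instance (Ω : Set E3) : NormedAddCommGroup (H0Curl Ω) :=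
  inferInstanceAs (NormedAddCommGroup (H0CurlSubmodule Ω))

instance (Ω : Set E3) : InnerProductSpace ℂ (H0Curl Ω) :=
  inferInstanceAs (InnerProductSpace ℂ (H0CurlSubmodule Ω))

/-- The pair `(u, curl u)` of an element of `H₀(curl, Ω)`. -/
def toPair (Ω : Set E3) : H0Curl Ω →L[ℂ] WithLp 2 (L2Field Ω × L2Field Ω) :=
  (H0CurlSubmodule Ω).subtypeL

lemma toPair_mem {Ω : Set E3} (u : H0Curl Ω) : toPair Ω u ∈ H0CurlSubmodule Ω := Subtype.prop _

/-- The field `u` underlying an element of `H₀(curl, Ω)`. -/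
def field0 {Ω : Set E3} (u : H0Curl Ω) : L2Field Ω := (toPair Ω u).fst

/-- The weak curl of an element of `H₀(curl, Ω)`. -/
def curl0 {Ω : Set E3} (u : H0Curl Ω) : L2Field Ω := (toPair Ω u).snd

/-! ### Complex conjugation on `H₀(curl, Ω)` -/

/-- The pair `(conj u, conj (curl u))`. -/
def conjPair {Ω : Set E3} (p : WithLp 2 (L2Field Ω × L2Field Ω)) :
    WithLp 2 (L2Field Ω × L2Field Ω) :=
  WithLp.toLp 2 (conjC3.compLp p.fst, conjC3.compLp p.snd)

lemma conj_conj_field {Ω : Set E3} (u : L2Field Ω) : conjC3.compLp (conjC3.compLp u) = u := by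
  refine Lp.ext ?_
  filter_upwards [conjC3.coeFn_compLp (conjC3.compLp u), conjC3.coeFn_compLp u] with x h1 h2
  rw [h1, h2, conjC3_conjC3]

lemma conjPair_conjPair {Ω : Set E3} (p : WithLp 2 (L2Field Ω × L2Field Ω)) :
    conjPair (conjPair p) = p := by
  have h1 : (conjPair (conjPair p)).fst = p.fst := conj_conj_field p.fst
  have h2 : (conjPair (conjPair p)).snd = p.snd := conj_conj_field p.snd
  exact (WithLp.ofLp_injective 2) (Prod.ext h1 h2)

lemma conjPair_mem {Ω : Set E3} {p : WithLp 2 (L2Field Ω × L2Field Ω)} (hp : p ∈ HCurl Ω) :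
    conjPair p ∈ HCurl Ω := by
  intro φ hφ
  have h := congrArg conj (hp _ hφ.conj)
  rw [← integral_dot_conj, ← integral_dot_conj] at h
  simp only [curl_conj (hφ.smooth.differentiable (by simp)), conjC3_conjC3] at h
  exact h

lemma integral_dot_conj' {Ω : Set E3} (u v : L2Field Ω) :
    ∫ x in Ω, dot ((conjC3.compLp u : L2Field Ω) x) ((conjC3.compLp v : L2Field Ω) x)
      = conj (∫ x in Ω, dot (u x) (v x)) := by
  rw [← integral_dot_conj]
  refine integral_congr_ae ?_
  filter_upwards [conjC3.coeFn_compLp v] with x hx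
  rw [hx]

lemma greenPairing_conj {Ω : Set E3} (p q : WithLp 2 (L2Field Ω × L2Field Ω)) :
    greenPairing (conjPair p) (conjPair q) = conj (greenPairing p q) := by
  rw [greenPairing_eq, greenPairing_eq, map_sub, ← integral_dot_conj', ← integral_dot_conj']
  rfl

/-- Complex conjugation `u ↦ conj u` on `H₀(curl, Ω)`. -/
def conj0 {Ω : Set E3} (u : H0Curl Ω) : H0Curl Ω :=
  ⟨conjPair (toPair Ω u), conjPair_mem (toPair_mem u).1, fun q hq => by
    rw [← conjPair_conjPair q, greenPairing_conj, (toPair_mem u).2 _ (conjPair_mem hq), map_zero]⟩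

/-! ### The sesquilinear form and the operator it induces -/

open Classical in
/-- The piecewise constant function with value `a` in the first material `Ω₁` and `b` in the
second one. -/
def twoPhase (Ω₁ : Set E3) (a b : ℂ) (x : E3) : ℂ := if x ∈ Ω₁ then a else b

/-- `ω ε`, where `Z = (ω ε₁, ω ε₂, ω μ₁, ω μ₂)`. -/
def omegaEps (Ω₁ : Set E3) (Z : Fin 4 → ℂ) : E3 → ℂ := twoPhase Ω₁ (Z 0) (Z 1)

/-- `ω μ`, where `Z = (ω ε₁, ω ε₂, ω μ₁, ω μ₂)`. -/
def omegaMu (Ω₁ : Set E3) (Z : Fin 4 → ℂ) : E3 → ℂ := twoPhase Ω₁ (Z 2) (Z 3)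

/-- The sesquilinear form
`a_Z(φ, ψ) = ∫_Ω -c² (ω μ)⁻¹ curl φ · conj (curl ψ) + ω ε φ · conj ψ`. -/
def sesqForm {Ω : Set E3} (c : ℝ) (Ω₁ : Set E3) (Z : Fin 4 → ℂ) (φ ψ : H0Curl Ω) : ℂ :=
  ∫ x in Ω, (-(c : ℂ) ^ 2 * (omegaMu Ω₁ Z x)⁻¹ * dot (curl0 φ x) (conjC3 (curl0 ψ x))
    + omegaEps Ω₁ Z x * dot (field0 φ x) (conjC3 (field0 ψ x)))

lemma twoPhase_bound (Ω₁ : Set E3) (a b : ℂ) (x : E3) : ‖twoPhase Ω₁ a b x‖ ≤ ‖a‖ + ‖b‖ := by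
  unfold twoPhase
  split_ifs
  · linarith [norm_nonneg b]
  · linarith [norm_nonneg a]

lemma twoPhase_measurable {Ω₁ : Set E3} (h : MeasurableSet Ω₁) (a b : ℂ) :
    Measurable (twoPhase Ω₁ a b) := Measurable.ite h measurable_const measurable_const

lemma memLp_twoPhase_smul {Ω Ω₁ : Set E3} (h : MeasurableSet Ω₁) (a b : ℂ) (u : L2Field Ω) :
    MemLp (fun x => twoPhase Ω₁ a b x • u x) 2 (volume.restrict Ω) := by
  refine (Lp.memLp u).of_le_mul (c := ‖a‖ + ‖b‖)
    ((twoPhase_measurable h a b).aestronglyMeasurable.smul (Lp.memLp u).1)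
    (Filter.Eventually.of_forall fun x => ?_)
  rw [norm_smul]
  exact mul_le_mul_of_nonneg_right (twoPhase_bound _ _ _ _) (norm_nonneg _)

/-- Multiplication of a square integrable field by a piecewise constant function. -/
def mulPhase {Ω Ω₁ : Set E3} (h : MeasurableSet Ω₁) (a b : ℂ) : L2Field Ω →L[ℂ] L2Field Ω :=
  LinearMap.mkContinuous
    { toFun := fun u => (memLp_twoPhase_smul h a b u).toLp
      map_add' := fun u v => by
        refine Lp.ext ?_
        filter_upwards [(memLp_twoPhase_smul h a b (u + v)).coeFn_toLp,
          (memLp_twoPhase_smul h a b u).coeFn_toLp, (memLp_twoPhase_smul h a b v).coeFn_toLp,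
          Lp.coeFn_add u v, Lp.coeFn_add (memLp_twoPhase_smul h a b u).toLp
            (memLp_twoPhase_smul h a b v).toLp] with x h1 h2 h3 h4 h5
        rw [h1, h5, Pi.add_apply, h2, h3, h4, Pi.add_apply, smul_add]
      map_smul' := fun c u => by
        refine Lp.ext ?_
        filter_upwards [(memLp_twoPhase_smul h a b (c • u)).coeFn_toLp,
          (memLp_twoPhase_smul h a b u).coeFn_toLp, Lp.coeFn_smul c u,
          Lp.coeFn_smul c (memLp_twoPhase_smul h a b u).toLp] with x h1 h2 h3 h4
        rw [h1, RingHom.id_apply, h4, Pi.smul_apply, h2, h3, Pi.smul_apply, smul_comm] }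
    (‖a‖ + ‖b‖) (fun u => by
      refine Lp.norm_le_mul_norm_of_ae_le_mul ?_
      filter_upwards [(memLp_twoPhase_smul h a b u).coeFn_toLp] with x hx
      refine (congrArg norm hx).le.trans ?_
      rw [norm_smul]
      exact mul_le_mul_of_nonneg_right (twoPhase_bound _ _ _ _) (norm_nonneg _))

lemma mulPhase_coeFn {Ω Ω₁ : Set E3} (h : MeasurableSet Ω₁) (a b : ℂ) (u : L2Field Ω) :
    ∀ᵐ x ∂(volume.restrict Ω), mulPhase h a b u x = twoPhase Ω₁ a b x • u x :=
  (memLp_twoPhase_smul h a b u).coeFn_toLp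

/-- `H₀(curl, Ω) → L²(Ω)`, `u ↦ u`, as a continuous linear map. -/
def fieldL (Ω : Set E3) : H0Curl Ω →L[ℂ] L2Field Ω :=
  (WithLp.fstL 2 ℂ (L2Field Ω) (L2Field Ω)).comp (toPair Ω)

/-- `H₀(curl, Ω) → L²(Ω)`, `u ↦ curl u`, as a continuous linear map. -/
def curlOpL (Ω : Set E3) : H0Curl Ω →L[ℂ] L2Field Ω :=
  (WithLp.sndL 2 ℂ (L2Field Ω) (L2Field Ω)).comp (toPair Ω)

/-- The bilinear form `(u, v) ↦ ∫_Ω κ u · v` on `L²(Ω)`, for a piecewise constant `κ`. -/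
def phasePairing {Ω Ω₁ : Set E3} (h : MeasurableSet Ω₁) (a b : ℂ) :
    L2Field Ω →L[ℂ] L2Field Ω →L[ℂ] ℂ :=
  (dotL.lpPairing (volume.restrict Ω) 2 2).comp (mulPhase h a b)

lemma phasePairing_apply {Ω Ω₁ : Set E3} (h : MeasurableSet Ω₁) (a b : ℂ) (u v : L2Field Ω) :
    phasePairing h a b u v = ∫ x in Ω, twoPhase Ω₁ a b x * dot (u x) (v x) := by
  have e := dotL.lpPairing_eq_integral (μ := volume.restrict Ω) (p := 2) (q := 2)
    (mulPhase h a b u) v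
  refine e.trans (integral_congr_ae ?_)
  filter_upwards [mulPhase_coeFn h a b u] with x hx
  rw [hx, map_smul]
  rfl

lemma integrable_phase {Ω Ω₁ : Set E3} (h : MeasurableSet Ω₁) (a b : ℂ) (u v : L2Field Ω) :
    Integrable (fun x => twoPhase Ω₁ a b x * dot (u x) (v x)) (volume.restrict Ω) :=
  (integrable_dot u v).bdd_mul (c := ‖a‖ + ‖b‖) (twoPhase_measurable h a b).aestronglyMeasurable
    (Filter.Eventually.of_forall (twoPhase_bound _ _ _))

lemma sesqForm_conj {Ω Ω₁ : Set E3} (h : MeasurableSet Ω₁) (c : ℝ) (Z : Fin 4 → ℂ)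
    (φ ψ : H0Curl Ω) :
    sesqForm c Ω₁ Z φ (conj0 ψ)
      = -(c : ℂ) ^ 2 * phasePairing h (Z 2)⁻¹ (Z 3)⁻¹ (curlOpL Ω φ) (curlOpL Ω ψ)
        + phasePairing h (Z 0) (Z 1) (fieldL Ω φ) (fieldL Ω ψ) := by
  rw [phasePairing_apply, phasePairing_apply, ← integral_const_mul,
    ← integral_add ((integrable_phase h _ _ _ _).const_mul _) (integrable_phase h _ _ _ _)]
  refine integral_congr_ae ?_
  filter_upwards [conjC3.coeFn_compLp (field0 ψ), conjC3.coeFn_compLp (curl0 ψ)] with x h3 h4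
  have e1 : conjC3 (curl0 (conj0 ψ) x) = curl0 ψ x := (congrArg conjC3 h4).trans (conjC3_conjC3 _)
  have e2 : conjC3 (field0 (conj0 ψ) x) = field0 ψ x :=
    (congrArg conjC3 h3).trans (conjC3_conjC3 _)
  have e3 : (omegaMu Ω₁ Z x)⁻¹ = twoPhase Ω₁ (Z 2)⁻¹ (Z 3)⁻¹ x := by
    simp only [omegaMu, twoPhase]; split_ifs <;> rfl
  rw [e1, e2, e3, mul_assoc]
  rfl

lemma sesqForm_bound {Ω Ω₁ : Set E3} (h : MeasurableSet Ω₁) (c : ℝ) (Z : Fin 4 → ℂ) :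
    ∃ M : ℝ, ∀ φ ψ : H0Curl Ω, ‖sesqForm c Ω₁ Z φ (conj0 ψ)‖ ≤ M * ‖φ‖ * ‖ψ‖ := by
  have hB : ∀ (P : L2Field Ω →L[ℂ] L2Field Ω →L[ℂ] ℂ) (S : H0Curl Ω →L[ℂ] L2Field Ω)
      (φ ψ : H0Curl Ω), ‖P (S φ) (S ψ)‖ ≤ ‖P‖ * (‖S‖ * ‖φ‖) * (‖S‖ * ‖ψ‖) := by
    intro P S φ ψ
    refine (P.le_opNorm₂ _ _).trans ?_
    gcongr
    · exact S.le_opNorm φ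
    · exact S.le_opNorm ψ
  refine ⟨‖-(c : ℂ) ^ 2‖ * (‖phasePairing (Ω := Ω) h (Z 2)⁻¹ (Z 3)⁻¹‖ * ‖curlOpL Ω‖ * ‖curlOpL Ω‖)
    + ‖phasePairing (Ω := Ω) h (Z 0) (Z 1)‖ * ‖fieldL Ω‖ * ‖fieldL Ω‖, fun φ ψ => ?_⟩
  rw [sesqForm_conj h]
  refine (norm_add_le _ _).trans ?_
  rw [norm_mul]
  have h1 := mul_le_mul_of_nonneg_left
    (hB (phasePairing h (Z 2)⁻¹ (Z 3)⁻¹) (curlOpL Ω) φ ψ) (norm_nonneg (-(c : ℂ) ^ 2))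
  have h2 := hB (phasePairing h (Z 0) (Z 1)) (fieldL Ω) φ ψ
  refine (add_le_add h1 h2).trans (le_of_eq ?_)
  ring

/-- The continuous linear operator `A_Z : H₀(curl, Ω) → H₀(curl, Ω)*` defined by
`⟨A_Z φ, ψ⟩ = a_Z(φ, conj ψ)`; the dual consists of the continuous linear functionals. -/
def opA {Ω Ω₁ : Set E3} (h : MeasurableSet Ω₁) (c : ℝ) (Z : Fin 4 → ℂ) :
    H0Curl Ω →L[ℂ] StrongDual ℂ (H0Curl Ω) :=
  LinearMap.mkContinuousOfExistsBound₂
    (LinearMap.mk₂ ℂ (fun φ ψ => sesqForm c Ω₁ Z φ (conj0 ψ))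
      (fun φ φ' ψ => by
        simp only [sesqForm_conj h, map_add, add_apply]; ring)
      (fun z φ ψ => by
        simp only [sesqForm_conj h, map_smul, smul_apply, smul_eq_mul]; ring)
      (fun φ ψ ψ' => by simp only [sesqForm_conj h, map_add]; ring)
      (fun z φ ψ => by simp only [sesqForm_conj h, map_smul, smul_eq_mul]; ring))
    (sesqForm_bound h c Z)

@[simp] lemma opA_apply {Ω Ω₁ : Set E3} (h : MeasurableSet Ω₁) (c : ℝ) (Z : Fin 4 → ℂ)
    (φ ψ : H0Curl Ω) : opA h c Z φ ψ = sesqForm c Ω₁ Z φ (conj0 ψ) := rfl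

end CurlCurl

end

open CurlCurl

/-!
The proof is a Lax–Milgram argument followed by analyticity of inversion.

*Coercivity.* If `z` has positive imaginary part, so does `-z⁻¹`. Hence, for `Z` with all
`(Z i).im > 0`, the coefficients `-c² (ω μ)⁻¹` and `ω ε` take finitely many values, all with
imaginary part at least some `δ > 0`, and taking the imaginary part of `a_Z(φ, φ)` gives
`δ (‖curl φ‖² + ‖φ‖²) ≤ Im a_Z(φ, φ)` (`exists_coercive`). Since `⟨A_Z φ, conj φ⟩ = a_Z(φ, φ)`
and conjugation is an isometry of `H₀(curl, Ω)`, the operator `A_Z` is bounded below.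

*Invertibility.* `H₀(curl, Ω)` is cut out of the Hilbert space `L² × L²` by continuous linear
equations, so it is complete. A bounded below operator has closed range, and a vector `v` orthogonal
to (the Riesz representatives of) the range satisfies `⟨A_Z (conj v), v⟩ = 0`, so `v = 0`
(`isInvertible_of_coercive`).

*Analyticity.* `A_Z` is a linear combination of four fixed operators, with coefficients
`(Z 2)⁻¹`, `(Z 3)⁻¹`, `Z 0`, `Z 1` (`opA_eq`); inversion of operators between Banach spaces is
analytic at every invertible operator.
-/

namespace CurlCurl

/-! ### Coercive operators from a Hilbert space to its dual -/

/-- A Lax–Milgram theorem for an operator `A` into the (bilinear) dual. The map `J` plays the role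
of a complex conjugation, turning the bilinear pairing `A φ ψ` into a sesquilinear form; of a
conjugation only the bound and the involutivity are needed. -/
theorem isInvertible_of_coercive {H : Type*} [NormedAddCommGroup H] [InnerProductSpace ℂ H]
    [CompleteSpace H] (A : H →L[ℂ] StrongDual ℂ H) (J : H → H) (hJ : ∀ v, J (J v) = v)
    (hJn : ∀ v, ‖J v‖ ≤ ‖v‖) {δ : ℝ} (hδ : 0 < δ) (hA : ∀ v, δ * ‖v‖ ^ 2 ≤ ‖A v (J v)‖) :
    A.IsInvertible := by
  have hbelow : ∀ v, δ * ‖v‖ ≤ ‖A v‖ := by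
    intro v
    rcases (norm_nonneg v).eq_or_lt with h | h
    · rw [← h, mul_zero]; exact norm_nonneg _
    · refine le_of_mul_le_mul_right ?_ h
      calc δ * ‖v‖ * ‖v‖ = δ * ‖v‖ ^ 2 := by ring
        _ ≤ ‖A v (J v)‖ := hA v
        _ ≤ ‖A v‖ * ‖J v‖ := (A v).le_opNorm _
        _ ≤ ‖A v‖ * ‖v‖ := by gcongr; exact hJn v
  have hanti : AntilipschitzWith (Real.toNNReal δ)⁻¹ A := by
    refine A.antilipschitz_of_bound fun v => ?_
    rw [NNReal.coe_inv, Real.coe_toNNReal δ hδ.le, inv_mul_eq_div, le_div_iff₀ hδ, mul_comm]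
    exact hbelow v
  have hclosed : IsClosed (Set.range A) := hanti.isClosed_range A.uniformContinuous
  -- The Riesz representatives of the range of `A`.
  let K : Submodule ℂ H :=
    A.range.comap ((InnerProductSpace.toDual ℂ H).toLinearEquiv : H →ₛₗ[starRingEnd ℂ] _)
  have hK : IsClosed (K : Set H) :=
    hclosed.preimage (InnerProductSpace.toDual ℂ H).continuous
  have : CompleteSpace K := hK.completeSpace_coe
  have hbot : Kᗮ = ⊥ := by
    refine (Submodule.eq_bot_iff _).2 fun v hv => ?_
    have hmem : (InnerProductSpace.toDual ℂ H).symm (A (J v)) ∈ K :=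
      ⟨J v, ((InnerProductSpace.toDual ℂ H).apply_symm_apply _).symm⟩
    have h0 : A (J v) v = 0 := by
      rw [← InnerProductSpace.toDual_symm_apply]
      exact (Submodule.mem_orthogonal _ _).1 hv _ hmem
    have h1 := hA (J v)
    rw [hJ, h0, norm_zero] at h1
    have h2 : ‖J v‖ = 0 := by
      by_contra hne
      have : 0 < ‖J v‖ := lt_of_le_of_ne (norm_nonneg _) (Ne.symm hne)
      have : 0 < δ * ‖J v‖ ^ 2 := by positivity
      linarith
    have h3 := hJn (J v)
    rw [hJ, h2] at h3
    exact norm_le_zero_iff.1 h3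
  have htop : K = ⊤ := Submodule.orthogonal_eq_bot_iff.1 hbot
  have hrange : A.range = ⊤ := by
    refine (Submodule.eq_top_iff').2 fun f => ?_
    have hf : (InnerProductSpace.toDual ℂ H).symm f ∈ K := htop ▸ Submodule.mem_top
    obtain ⟨φ, hφ⟩ := hf
    exact ⟨φ, hφ.trans ((InnerProductSpace.toDual ℂ H).apply_symm_apply _)⟩
  exact ⟨ContinuousLinearEquiv.ofBijective A (LinearMap.ker_eq_bot.2 hanti.injective) hrange, rfl⟩

/-! ### Completeness of `H₀(curl, Ω)` -/

/-- The functional `u ↦ ∫_Ω u · f` on `L²(Ω)` is continuous, for square integrable `f`. -/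
lemma continuous_integral_dot {Ω : Set E3} {f : E3 → C3} (hf : MemLp f 2 (volume.restrict Ω)) :
    Continuous fun u : L2Field Ω => ∫ x in Ω, dot (u x) (f x) := by
  have e : (fun u : L2Field Ω => ∫ x in Ω, dot (u x) (f x))
      = fun u => dotL.lpPairing (volume.restrict Ω) 2 2 u hf.toLp := by
    funext u
    rw [dotL.lpPairing_eq_integral]
    refine integral_congr_ae ?_
    filter_upwards [hf.coeFn_toLp] with x hx
    rw [hx, dotL_apply]
  rw [e]
  fun_prop

lemma isClosed_HCurl (Ω : Set E3) : IsClosed (HCurl Ω : Set (WithLp 2 (L2Field Ω × L2Field Ω))) := by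
  have e : (HCurl Ω : Set (WithLp 2 (L2Field Ω × L2Field Ω)))
      = ⋂ (φ : E3 → C3) (_ : IsTestField Ω φ), {p | ∫ x in Ω, dot (p.fst x) (curl φ x)
          = ∫ x in Ω, dot (p.snd x) (φ x)} := by
    ext p
    simp only [mem_iInter]
    rfl
  rw [e]
  refine isClosed_iInter fun φ => isClosed_iInter fun hφ => isClosed_eq ?_ ?_
  · exact (continuous_integral_dot (hφ.curl_memLp _)).comp
      (WithLp.fstL 2 ℂ (L2Field Ω) (L2Field Ω)).continuous
  · exact (continuous_integral_dot (hφ.memLp _)).comp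
      (WithLp.sndL 2 ℂ (L2Field Ω) (L2Field Ω)).continuous

lemma isClosed_H0CurlSubmodule (Ω : Set E3) :
    IsClosed (H0CurlSubmodule Ω : Set (WithLp 2 (L2Field Ω × L2Field Ω))) := by
  have e : (H0CurlSubmodule Ω : Set (WithLp 2 (L2Field Ω × L2Field Ω)))
      = (HCurl Ω : Set (WithLp 2 (L2Field Ω × L2Field Ω))) ∩ ⋂ q ∈ HCurl Ω, {p | (∫ x in Ω, dot (p.fst x) (q.snd x))
          - ∫ x in Ω, dot (p.snd x) (q.fst x) = 0} := by
    ext p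
    simp only [mem_inter_iff, mem_iInter, mem_ofPred_eq, ← greenPairing_eq]
    rfl
  rw [e]
  refine (isClosed_HCurl Ω).inter <| isClosed_biInter fun q _ =>
    isClosed_eq (Continuous.sub ?_ ?_) continuous_const
  · exact (continuous_integral_dot (Lp.memLp q.snd)).comp
      (WithLp.fstL 2 ℂ (L2Field Ω) (L2Field Ω)).continuous
  · exact (continuous_integral_dot (Lp.memLp q.fst)).comp
      (WithLp.sndL 2 ℂ (L2Field Ω) (L2Field Ω)).continuous

instance (Ω : Set E3) : CompleteSpace (H0Curl Ω) :=
  (isClosed_H0CurlSubmodule Ω).completeSpace_coe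

/-! ### Coercivity of the sesquilinear form -/

lemma norm_sq_eq_field_add_curl {Ω : Set E3} (u : H0Curl Ω) :
    ‖u‖ ^ 2 = ‖fieldL Ω u‖ ^ 2 + ‖curlOpL Ω u‖ ^ 2 :=
  WithLp.prod_norm_sq_eq_of_L2 (toPair Ω u)

lemma conj0_conj0 {Ω : Set E3} (u : H0Curl Ω) : conj0 (conj0 u) = u :=
  Subtype.ext (conjPair_conjPair (toPair Ω u))

lemma norm_conj_field {Ω : Set E3} (u : L2Field Ω) : ‖(conjC3.compLp u : L2Field Ω)‖ = ‖u‖ := by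
  have h : ∀ᵐ x ∂(volume.restrict Ω), ‖(conjC3.compLp u : L2Field Ω) x‖ = ‖u x‖ := by
    filter_upwards [conjC3.coeFn_compLp u] with x hx
    rw [hx, norm_conjC3]
  exact le_antisymm (Lp.norm_le_norm_of_ae_le (h.mono fun _ hx => hx.le))
    (Lp.norm_le_norm_of_ae_le (h.mono fun _ hx => hx.ge))

lemma norm_conj0 {Ω : Set E3} (u : H0Curl Ω) : ‖conj0 u‖ = ‖u‖ := by
  rw [← sq_eq_sq₀ (norm_nonneg _) (norm_nonneg _), norm_sq_eq_field_add_curl,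
    norm_sq_eq_field_add_curl]
  exact congrArg₂ (fun a b : ℝ => a ^ 2 + b ^ 2) (norm_conj_field _) (norm_conj_field _)

lemma dot_conjC3_self (a : C3) : dot a (conjC3 a) = ((‖a‖ ^ 2 : ℝ) : ℂ) := by
  simp [dot, EuclideanSpace.norm_sq_eq, Complex.mul_conj, Complex.normSq_eq_norm_sq]

lemma L2Field_norm_sq {Ω : Set E3} (u : L2Field Ω) : ‖u‖ ^ 2 = ∫ x in Ω, ‖u x‖ ^ 2 := by
  have h : ((‖u‖ ^ 2 : ℝ) : ℂ) = ((∫ x in Ω, ‖u x‖ ^ 2 : ℝ) : ℂ) := by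
    rw [← integral_complex_ofReal]
    have h1 := inner_self_eq_norm_sq_to_K (𝕜 := ℂ) u
    rw [L2.inner_def] at h1
    push_cast
    refine h1.symm.trans (integral_congr_ae (Filter.Eventually.of_forall fun x => ?_))
    exact inner_self_eq_norm_sq_to_K (𝕜 := ℂ) (u x)
  exact_mod_cast h

/-- A lower bound on the imaginary part of both values of a piecewise constant coefficient bounds
below the imaginary part of the associated quadratic form. -/
lemma le_im_phasePairing {Ω Ω₁ : Set E3} (h : MeasurableSet Ω₁) {k a b : ℂ} {δ : ℝ}
    (ha : δ ≤ (k * a).im) (hb : δ ≤ (k * b).im) (u : L2Field Ω) :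
    δ * ‖u‖ ^ 2 ≤ (k * phasePairing h a b u (conjC3.compLp u : L2Field Ω)).im := by
  rw [phasePairing_apply, ← integral_const_mul, L2Field_norm_sq, ← integral_const_mul]
  have hi := (integrable_phase h a b u (conjC3.compLp u : L2Field Ω)).const_mul k
  have him := Complex.imCLM.integral_comp_comm hi
  simp only [Complex.imCLM_apply] at him
  rw [← him]
  refine integral_mono_ae ((Lp.memLp u).norm.integrable_sq.const_mul δ)
    (Complex.imCLM.integrable_comp hi) ?_
  filter_upwards [conjC3.coeFn_compLp u] with x hx
  rw [hx, dot_conjC3_self, ← mul_assoc, Complex.im_mul_ofReal]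
  refine mul_le_mul_of_nonneg_right ?_ (sq_nonneg _)
  unfold twoPhase
  split_ifs <;> assumption

lemma im_neg_sq_mul_inv_pos {c : ℝ} (hc : 0 < c) {z : ℂ} (hz : 0 < z.im) :
    0 < (-(c : ℂ) ^ 2 * z⁻¹).im := by
  have hz0 : z ≠ 0 := fun h => by simp [h] at hz
  have e : (-(c : ℂ) ^ 2 * z⁻¹).im = c ^ 2 * (z.im / Complex.normSq z) := by
    rw [← Complex.ofReal_pow, ← Complex.ofReal_neg, Complex.im_ofReal_mul, Complex.inv_im]
    ring
  rw [e]
  have := Complex.normSq_pos.2 hz0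
  positivity

/-- Coercivity: the imaginary part of `a_Z(φ, φ) = ⟨A_Z φ, conj φ⟩` controls the norm of
`H₀(curl, Ω)`. -/
lemma exists_coercive {Ω Ω₁ : Set E3} (h : MeasurableSet Ω₁) {c : ℝ} (hc : 0 < c)
    {Z : Fin 4 → ℂ} (hZ : ∀ i, 0 < (Z i).im) :
    ∃ δ : ℝ, 0 < δ ∧ ∀ φ : H0Curl Ω, δ * ‖φ‖ ^ 2 ≤ ‖opA h c Z φ (conj0 φ)‖ := by
  set m₁ := (-(c : ℂ) ^ 2 * (Z 2)⁻¹).im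
  set m₂ := (-(c : ℂ) ^ 2 * (Z 3)⁻¹).im
  have h₁ : 0 < m₁ := im_neg_sq_mul_inv_pos hc (hZ 2)
  have h₂ : 0 < m₂ := im_neg_sq_mul_inv_pos hc (hZ 3)
  refine ⟨min (min m₁ m₂) (min (Z 0).im (Z 1).im),
    lt_min (lt_min h₁ h₂) (lt_min (hZ 0) (hZ 1)), fun φ => ?_⟩
  set δ := min (min m₁ m₂) (min (Z 0).im (Z 1).im)
  have hcurl := le_im_phasePairing (Ω := Ω) h (k := -(c : ℂ) ^ 2) (δ := δ)
    ((min_le_left _ _).trans (min_le_left _ _)) ((min_le_left _ _).trans (min_le_right _ _))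
    (curlOpL Ω φ)
  have hfield := le_im_phasePairing (Ω := Ω) h (k := 1) (a := Z 0) (b := Z 1) (δ := δ)
    (by rw [one_mul]; exact (min_le_right _ _).trans (min_le_left _ _))
    (by rw [one_mul]; exact (min_le_right _ _).trans (min_le_right _ _)) (fieldL Ω φ)
  rw [one_mul] at hfield
  refine le_trans ?_ ((le_abs_self _).trans (Complex.abs_im_le_norm _))
  rw [opA_apply, sesqForm_conj h, Complex.add_im, norm_sq_eq_field_add_curl, mul_add, add_comm]
  exact add_le_add hcurl hfield

/-! ### Analytic dependence on the material parameters -/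

lemma phasePairing_eq_add {Ω Ω₁ : Set E3} (h : MeasurableSet Ω₁) (a b : ℂ) (u v : L2Field Ω) :
    phasePairing h a b u v = a * phasePairing h 1 0 u v + b * phasePairing h 0 1 u v := by
  simp only [phasePairing_apply]
  rw [← integral_const_mul, ← integral_const_mul, ← integral_add
    ((integrable_phase h _ _ _ _).const_mul _) ((integrable_phase h _ _ _ _).const_mul _)]
  refine integral_congr_ae (Filter.Eventually.of_forall fun x => ?_)
  simp only [twoPhase]
  split_ifs <;> simp

/-- The operator `H₀(curl, Ω) → H₀(curl, Ω)*` given by the form `∫_Ω κ S φ · S ψ`, where `κ` has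
the values `a` and `b` in the two materials. -/
noncomputable def phaseOp {Ω Ω₁ : Set E3} (h : MeasurableSet Ω₁) (S : H0Curl Ω →L[ℂ] L2Field Ω) (a b : ℂ) :
    H0Curl Ω →L[ℂ] StrongDual ℂ (H0Curl Ω) :=
  (phasePairing h a b).bilinearComp S S

/-- `A_Z` as a combination of four operators independent of `Z`. -/
lemma opA_eq {Ω Ω₁ : Set E3} (h : MeasurableSet Ω₁) (c : ℝ) (Z : Fin 4 → ℂ) :
    opA (Ω := Ω) h c Z = (-(c : ℂ) ^ 2) • ((Z 2)⁻¹ • phaseOp h (curlOpL Ω) 1 0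
        + (Z 3)⁻¹ • phaseOp h (curlOpL Ω) 0 1)
      + (Z 0 • phaseOp h (fieldL Ω) 1 0 + Z 1 • phaseOp h (fieldL Ω) 0 1) := by
  ext φ ψ
  rw [opA_apply, sesqForm_conj h, phasePairing_eq_add h (Z 2)⁻¹, phasePairing_eq_add h (Z 0)]
  rfl

/-- Stated over an abstract normed space `F`; here `F` is the space of operators from
`H₀(curl, Ω)` to its dual. -/
lemma contDiffAt_parameter_combination {F : Type*} [NormedAddCommGroup F] [NormedSpace ℂ F]
    (k : ℂ) (P Q R S : F) {Z : Fin 4 → ℂ} (h2 : Z 2 ≠ 0) (h3 : Z 3 ≠ 0) :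
    ContDiffAt ℂ ω (fun Z : Fin 4 → ℂ =>
      k • ((Z 2)⁻¹ • P + (Z 3)⁻¹ • Q) + (Z 0 • R + Z 1 • S)) Z := by
  have hp : ∀ i, ContDiffAt ℂ ω (fun Z : Fin 4 → ℂ => Z i) Z := fun i =>
    contDiffAt_apply ℂ ℂ i Z
  exact (((((hp 2).inv h2).smul contDiffAt_const).add
    (((hp 3).inv h3).smul contDiffAt_const)).const_smul _).add
      (((hp 0).smul contDiffAt_const).add ((hp 1).smul contDiffAt_const))

lemma contDiffAt_opA {Ω Ω₁ : Set E3} (h : MeasurableSet Ω₁) (c : ℝ) {Z : Fin 4 → ℂ}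
    (h2 : Z 2 ≠ 0) (h3 : Z 3 ≠ 0) : ContDiffAt ℂ ω (fun Z => opA (Ω := Ω) h c Z) Z := by
  simp only [opA_eq]
  exact contDiffAt_parameter_combination _ _ _ _ _ h2 h3

end CurlCurl

theorem mainTheorem7 (Ω : Set E3) (hΩ : IsBoundedLipschitzDomain Ω)
    (Ω₁ : Set E3) (hΩ₁ : MeasurableSet Ω₁) (hΩ₁Ω : Ω₁ ⊆ Ω) (c : ℝ) (hc : 0 < c) :
    (∀ Z : Fin 4 → ℂ, (∀ i, 0 < (Z i).im) →
      (opA hΩ₁ c Z : H0Curl Ω →L[ℂ] StrongDual ℂ (H0Curl Ω)).IsInvertible) ∧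
    AnalyticOnNhd ℂ
      (fun Z : Fin 4 → ℂ =>
        (opA hΩ₁ c Z : H0Curl Ω →L[ℂ] StrongDual ℂ (H0Curl Ω)).inverse)
      {Z : Fin 4 → ℂ | ∀ i, 0 < (Z i).im} := by
  have hinv : ∀ Z : Fin 4 → ℂ, (∀ i, 0 < (Z i).im) →
      (opA hΩ₁ c Z : H0Curl Ω →L[ℂ] StrongDual ℂ (H0Curl Ω)).IsInvertible := by
    intro Z hZ
    obtain ⟨δ, hδ, hco⟩ := exists_coercive (Ω := Ω) hΩ₁ hc hZ
    exact isInvertible_of_coercive _ conj0 conj0_conj0 (fun v => (norm_conj0 v).le) hδ hco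
  refine ⟨hinv, fun Z hZ => ContDiffAt.analyticAt ?_⟩
  have hne : ∀ i, Z i ≠ 0 := fun i h => (hZ i).ne' (by simp [h])
  exact (hinv Z hZ).contDiffAt_map_inverse.comp Z (contDiffAt_opA hΩ₁ c (hne 2) (hne 3))
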